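/- A binary tree is either empty or a root node with an ordered pair of binary trees (its left and right subtrees); its size is its number of nodes. The right rotation at a node of a binary tree replaces a subtree $y(x(A,B),C)$ by $x(A,y(B,C))$, where $A,B,C$ are (possibly empty) binary trees and $r(L,R)$ denotes the tree with root $r$, left subtree $L$ and right subtree $R$. In the Tamari order on binary trees of size $n$, $T_1\le T_2$ if and only if $T_2$ is obtained from $T_1$ by a finite (possibly empty) sequence of right rotations. For $n,m\ge 0$ let $I_{n,m}$ be the number of intervals $[T_1,T_2]$, i.e. of pairs $T_1\le T_2$, of trees of size $n$ such that $T_1$ has exactly $m$ nodes on its leftmost branch (the root, its left child, the left child of that, and so on), and let $$\Phi(x,y)=\sum_{n,m\ge 0} I_{n,m}\,x^m y^n\in\mathbb{Z}[x][[y]].$$ **Theorem.** The generating function $\Phi$ satisfies the functional equation $$\Phi = \mathcal{B}(\Phi,\Phi)+1,$$ where, for $f,g\in\mathbb{Z}[x][[y]]$, $$\mathcal{B}(f,g)= x\,y\,f(x,y)\,\frac{x\,g(x,y)-g(1,y)}{x-1}.$$ (The division is exact in $\mathbb{Z}[x][[y]]$: every coefficient in $y$ of $x\,g(x,y)-g(1,y)$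 vanishes at $x=1$.) -/

import Mathlib

open Polynomial PowerSeries

noncomputable section

/-- The right rotation at some node of a planar binary tree: a subtree `y(x(A, B), C)` is replaced
by `x(A, y(B, C))`. -/
inductive RightRotation : BinaryTree Unit → BinaryTree Unit → Prop
  | root (A B C : BinaryTree Unit) :
      RightRotation (.node () (.node () A B) C) (.node () A (.node () B C))
  | left {L L' : BinaryTree Unit} (R : BinaryTree Unit) :
      RightRotation L L' → RightRotation (.node () L R) (.node () L' R)
  | right (L : BinaryTree Unit) {R R' : BinaryTree Unit} :
      RightRotation R R' → RightRotation (.node () L R) (.node () L R')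

/-- The Tamari order: `T₁ ≤ T₂` if `T₂` is obtained from `T₁` by a (possibly empty) sequence of
right rotations. -/
def TamariLE (T₁ T₂ : BinaryTree Unit) : Prop :=
  Relation.ReflTransGen RightRotation T₁ T₂

/-- The number of nodes on the leftmost branch of a tree (the root and its iterated left
children). -/
def leftBranchNodes : BinaryTree Unit → ℕ
  | .nil => 0
  | .node _ L _ => leftBranchNodes L + 1

theorem leftBranchNodes_le_numNodes (T : BinaryTree Unit) : leftBranchNodes T ≤ T.numNodes := by
  induction T with
  | nil => simp [leftBranchNodes]
  | node _ L R hL _ => simp only [leftBranchNodes, BinaryTree.numNodes]; omega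

open Classical in
/-- The intervals `[T₁, T₂]` of the Tamari order on trees of size `n`, given by their end points,
such that `T₁` has exactly `m` nodes on its leftmost branch. -/
def tamariIntervals (n m : ℕ) : Finset (BinaryTree Unit × BinaryTree Unit) :=
  (BinaryTree.treesOfNumNodesEq n ×ˢ BinaryTree.treesOfNumNodesEq n).filter
    fun T => TamariLE T.1 T.2 ∧ leftBranchNodes T.1 = m

theorem mem_tamariIntervals {n m : ℕ} {T : BinaryTree Unit × BinaryTree Unit} :
    T ∈ tamariIntervals n m ↔ T.1.numNodes = n ∧ T.2.numNodes = n ∧ TamariLE T.1 T.2 ∧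
      leftBranchNodes T.1 = m := by
  simp [tamariIntervals, and_assoc]

/-- The generating function `Φ(x, y) = ∑ I_{n,m} x ^ m y ^ n`, as a power series in `y` whose
coefficients are polynomials in `x`; the coefficient of `y ^ n` has degree at most `n`, since a tree
of size `n` has at most `n` nodes on its leftmost branch. -/
def tamariGF : ℤ[X]⟦X⟧ :=
  PowerSeries.mk fun n =>
    ∑ m ∈ Finset.range (n + 1), Polynomial.C ((tamariIntervals n m).card : ℤ) * Polynomial.X ^ m

theorem coeff_coeff_tamariGF (n m : ℕ) :
    (PowerSeries.coeff n tamariGF).coeff m = (tamariIntervals n m).card := by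
  simp only [tamariGF, PowerSeries.coeff_mk, Polynomial.finsetSum_coeff,
    Polynomial.coeff_C_mul_X_pow]
  rw [Finset.sum_ite_eq]
  split_ifs with h
  · rfl
  · symm
    rw [Nat.cast_eq_zero, Finset.card_eq_zero, Finset.eq_empty_iff_forall_notMem]
    intro T hT
    obtain ⟨h1, -, -, h4⟩ := mem_tamariIntervals.1 hT
    have := leftBranchNodes_le_numNodes T.1
    simp at h
    omega

/-- The variable `x`. -/
def xVar : ℤ[X]⟦X⟧ := PowerSeries.C Polynomial.X

/-- The variable `y`. -/
def yVar : ℤ[X]⟦X⟧ := PowerSeries.X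

/-- The specialization `g(x, y) ↦ g(1, y)`. -/
def atXOne (g : ℤ[X]⟦X⟧) : ℤ[X]⟦X⟧ :=
  PowerSeries.map (Polynomial.C.comp (Polynomial.evalRingHom 1)) g

/-- The quotient `h / (x - 1)`, computed in each coefficient of `y`. It is used only for series `h`
that `x - 1` divides. -/
def divXSubOne (h : ℤ[X]⟦X⟧) : ℤ[X]⟦X⟧ :=
  PowerSeries.mk fun n => PowerSeries.coeff n h /ₘ (Polynomial.X - Polynomial.C 1)

/-- The division by `x - 1` is exact on `x g(x, y) - g(1, y)`. -/
theorem xVar_sub_one_mul_divXSubOne (g : ℤ[X]⟦X⟧) :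
    (xVar - 1) * divXSubOne (xVar * g - atXOne g) = xVar * g - atXOne g := by
  have hx : (xVar - 1 : ℤ[X]⟦X⟧) = PowerSeries.C (Polynomial.X - Polynomial.C 1) := by
    simp [xVar]
  rw [hx]
  ext1 n
  rw [PowerSeries.coeff_C_mul, divXSubOne, PowerSeries.coeff_mk,
    Polynomial.mul_divByMonic_eq_iff_isRoot]
  simp [xVar, atXOne, PowerSeries.coeff_C_mul, Polynomial.IsRoot]

/-- The bilinear operator `B(f, g) = x y f(x, y) (x g(x, y) - g(1, y)) / (x - 1)`. -/
def tamariB (f g : ℤ[X]⟦X⟧) : ℤ[X]⟦X⟧ :=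
  xVar * yVar * f * divXSubOne (xVar * g - atXOne g)

end

/-! Decompose an interval at the root `node L R` of its upper end. The trees below `node L R` are
exactly those obtained from some `L' ≤ L` and `R' ≤ R` by inserting a node carrying `L'` somewhere
on the left branch of `R'` (`tamariLE_node_iff`), and once the size of `L'` is fixed this
description is unique (`graftLeftBranch_injective`). An interval of size `n + 1` is thus a pair of
intervals together with a position `j ≤ ℓ`, where `ℓ` counts the left branch of `R'`. Its weight is
`x ^ (ℓ(L') + 1 + j)`, and summing over `j` gives `x * x ^ ℓ(L') * (x ^ (ℓ + 1) - 1) / (x - 1)`, the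
contribution of the pair to the operator `B`. -/

/-- The tree obtained from `R` by inserting a new node with left subtree `L` in the leftmost branch,
below its `j` uppermost nodes: the rest of `R` becomes the right subtree of the new node. -/
def graftLeftBranch (L : BinaryTree Unit) : BinaryTree Unit → ℕ → BinaryTree Unit
  | R, 0 => .node () L R
  -- Junk value, chosen so that the size formula and the comparison with `node L R` hold for every
  -- `j`.
  | .nil, _ + 1 => .node () L .nil
  | .node _ R B, j + 1 => .node () (graftLeftBranch L R j) B

theorem graftLeftBranch_zero (L R : BinaryTree Unit) :
    graftLeftBranch L R 0 = .node () L R := by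
  cases R <;> rfl

theorem graftLeftBranch_node_succ (L R B : BinaryTree Unit) (j : ℕ) :
    graftLeftBranch L (.node () R B) (j + 1) = .node () (graftLeftBranch L R j) B := rfl

theorem numNodes_graftLeftBranch (L R : BinaryTree Unit) (j : ℕ) :
    (graftLeftBranch L R j).numNodes = L.numNodes + R.numNodes + 1 := by
  induction R generalizing j with
  | nil => cases j <;> simp [graftLeftBranch, BinaryTree.numNodes]
  | node _ R B ih _ =>
    cases j with
    | zero => simp [graftLeftBranch_zero, BinaryTree.numNodes]
    | succ j => simp only [graftLeftBranch, BinaryTree.numNodes, ih]; omega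

theorem leftBranchNodes_graftLeftBranch (L R : BinaryTree Unit) (j : ℕ)
    (hj : j ≤ leftBranchNodes R) :
    leftBranchNodes (graftLeftBranch L R j) = leftBranchNodes L + 1 + j := by
  induction R generalizing j with
  | nil =>
    obtain rfl : j = 0 := by simpa [leftBranchNodes] using hj
    simp [graftLeftBranch_zero, leftBranchNodes]
  | node _ R B ih _ =>
    cases j with
    | zero => simp [graftLeftBranch_zero, leftBranchNodes]
    | succ j =>
      simp only [leftBranchNodes] at hj
      simp only [graftLeftBranch, leftBranchNodes, ih j (by omega)]
      omega

/-- Left subtrees strictly shrink down the left branch, so the size of `L` singles out the inserted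
node. Without `hL`, any node of the branch could play that role. -/
theorem graftLeftBranch_injective {L L' R R' : BinaryTree Unit} {j j' : ℕ}
    (hL : L.numNodes = L'.numNodes) (hj : j ≤ leftBranchNodes R) (hj' : j' ≤ leftBranchNodes R')
    (h : graftLeftBranch L R j = graftLeftBranch L' R' j') : L = L' ∧ R = R' ∧ j = j' := by
  induction j generalizing R R' j' with
  | zero =>
    rw [graftLeftBranch_zero] at h
    cases j' with
    | zero =>
      rw [graftLeftBranch_zero] at h
      injection h with _ h1 h2
      exact ⟨h1, h2, rfl⟩
    | succ j' =>
      cases R' with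
      | nil => simp [leftBranchNodes] at hj'
      | node _ R' B' =>
        rw [graftLeftBranch_node_succ] at h
        injection h with _ h1 h2
        have := numNodes_graftLeftBranch L' R' j'
        rw [← h1] at this
        omega
  | succ j ih =>
    cases R with
    | nil => simp [leftBranchNodes] at hj
    | node _ R B =>
      rw [graftLeftBranch_node_succ] at h
      cases j' with
      | zero =>
        rw [graftLeftBranch_zero] at h
        injection h with _ h1 h2
        have := numNodes_graftLeftBranch L R j
        rw [h1] at this
        omega
      | succ j' =>
        cases R' with
        | nil => simp [leftBranchNodes] at hj'
        | node _ R' B' =>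
          rw [graftLeftBranch_node_succ] at h
          injection h with _ h1 h2
          simp only [leftBranchNodes] at hj hj'
          obtain ⟨rfl, rfl, rfl⟩ := ih (by omega) (by omega) h1
          exact ⟨rfl, by rw [h2], rfl⟩

theorem RightRotation.numNodes_eq {T T' : BinaryTree Unit} (h : RightRotation T T') :
    T.numNodes = T'.numNodes := by
  induction h with
  | root => simp only [BinaryTree.numNodes]; omega
  | left R _ ih => simp only [BinaryTree.numNodes, ih]
  | right L _ ih => simp only [BinaryTree.numNodes, ih]

theorem TamariLE.numNodes_eq {T T' : BinaryTree Unit} (h : TamariLE T T') :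
    T.numNodes = T'.numNodes := by
  induction h with
  | refl => rfl
  | tail _ h ih => exact ih.trans h.numNodes_eq

theorem TamariLE.node {L L' R R' : BinaryTree Unit} (hL : TamariLE L L') (hR : TamariLE R R') :
    TamariLE (.node () L R) (.node () L' R') := by
  have h₁ : TamariLE (.node () L R) (.node () L' R) := by
    induction hL with
    | refl => exact .refl
    | tail _ h ih => exact ih.tail (.left R h)
  have h₂ : TamariLE (.node () L' R) (.node () L' R') := by
    induction hR with
    | refl => exact .refl
    | tail _ h ih => exact ih.tail (.right L' h)
  exact h₁.trans h₂

/-- Right rotations lift the inserted node up the left branch to the root. -/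
theorem tamariLE_graftLeftBranch (L R : BinaryTree Unit) (j : ℕ) :
    TamariLE (graftLeftBranch L R j) (.node () L R) := by
  induction R generalizing j with
  | nil => cases j <;> exact .refl
  | node _ R B ih _ =>
    cases j with
    | zero => exact .refl
    | succ j => exact (TamariLE.node (ih j) .refl).tail (.root L R B)

/-- Undoing one rotation preserves the grafted form: it acts inside `L`, inside `R`, or moves the
inserted node one step down. -/
theorem RightRotation.exists_eq_graftLeftBranch {T L R : BinaryTree Unit} {j : ℕ}
    (hj : j ≤ leftBranchNodes R) (h : RightRotation T (graftLeftBranch L R j)) :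
    ∃ L' R' j', TamariLE L' L ∧ TamariLE R' R ∧ j' ≤ leftBranchNodes R' ∧
      T = graftLeftBranch L' R' j' := by
  induction j generalizing T R with
  | zero =>
    rw [graftLeftBranch_zero] at h
    cases h with
    | root _ B C =>
      exact ⟨L, .node () B C, 1, .refl, .refl, by simp [leftBranchNodes],
        by rw [graftLeftBranch_node_succ, graftLeftBranch_zero]⟩
    | left _ h => exact ⟨_, R, 0, .single h, .refl, Nat.zero_le _, (graftLeftBranch_zero _ _).symm⟩
    | right _ h => exact ⟨L, _, 0, .refl, .single h, Nat.zero_le _, (graftLeftBranch_zero _ _).symm⟩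
  | succ j ih =>
    cases R with
    | nil => simp [leftBranchNodes] at hj
    | node _ R B =>
      rw [graftLeftBranch_node_succ] at h
      simp only [leftBranchNodes] at hj
      generalize hG : graftLeftBranch L R j = G at h
      cases h with
      | root _ B C =>
        subst hG
        -- Undoing the rotation at the root of `R` adds a node to its left branch above the inserted
        -- one.
        exact ⟨L, .node () (.node () R B) C, j + 2, .refl, .single (.root R B C),
          by simp only [leftBranchNodes]; omega, rfl⟩
      | left _ h =>
        subst hG
        obtain ⟨L', R', j', hL, hR, hj', rfl⟩ := ih (by omega) h
        exact ⟨L', .node () R' B, j' + 1, hL, .node hR .refl,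
          by simp only [leftBranchNodes]; omega, rfl⟩
      | @right _ B' _ h =>
        subst hG
        exact ⟨L, .node () R B', j + 1, .refl, .single (.right R h),
          by simp only [leftBranchNodes]; omega, rfl⟩

/-- The trees below `node L R` in the Tamari order are the trees `graftLeftBranch L' R' j` with
`L' ≤ L` and `R' ≤ R`. -/
theorem tamariLE_node_iff {T L R : BinaryTree Unit} :
    TamariLE T (.node () L R) ↔ ∃ L' R' j, TamariLE L' L ∧ TamariLE R' R ∧
      j ≤ leftBranchNodes R' ∧ T = graftLeftBranch L' R' j := by
  constructor
  · intro h
    induction h using Relation.ReflTransGen.head_induction_on with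
    | refl => exact ⟨L, R, 0, .refl, .refl, Nat.zero_le _, (graftLeftBranch_zero _ _).symm⟩
    | head h _ ih =>
      obtain ⟨L', R', j, hL, hR, hj, rfl⟩ := ih
      obtain ⟨L'', R'', j', hL', hR', hj', rfl⟩ := h.exists_eq_graftLeftBranch hj
      exact ⟨L'', R'', j', hL'.trans hL, hR'.trans hR, hj', rfl⟩
  · rintro ⟨L', R', j, hL, hR, -, rfl⟩
    exact (tamariLE_graftLeftBranch L' R' j).trans (hL.node hR)

open Classical in
/-- The intervals of the Tamari order on trees of size `n`, given by their end points. -/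
noncomputable def allTamariIntervals (n : ℕ) : Finset (BinaryTree Unit × BinaryTree Unit) :=
  (BinaryTree.treesOfNumNodesEq n ×ˢ BinaryTree.treesOfNumNodesEq n).filter
    fun T => TamariLE T.1 T.2

theorem mem_allTamariIntervals {n : ℕ} {T : BinaryTree Unit × BinaryTree Unit} :
    T ∈ allTamariIntervals n ↔ T.1.numNodes = n ∧ T.2.numNodes = n ∧ TamariLE T.1 T.2 := by
  simp [allTamariIntervals, and_assoc]

theorem coeff_tamariGF (n : ℕ) :
    PowerSeries.coeff n tamariGF =
      ∑ T ∈ allTamariIntervals n, (Polynomial.X : ℤ[X]) ^ leftBranchNodes T.1 := by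
  classical
  have hmap : ∀ T ∈ allTamariIntervals n, leftBranchNodes T.1 ∈ Finset.range (n + 1) := by
    intro T hT
    have h := (mem_allTamariIntervals.1 hT).1
    have := leftBranchNodes_le_numNodes T.1
    simp only [Finset.mem_range]
    omega
  rw [tamariGF, PowerSeries.coeff_mk, ← Finset.sum_fiberwise_of_maps_to hmap]
  refine Finset.sum_congr rfl fun m _ => ?_
  have hfilter : (allTamariIntervals n).filter (fun T => leftBranchNodes T.1 = m) =
      tamariIntervals n m := by
    ext T
    rw [Finset.mem_filter, mem_allTamariIntervals, mem_tamariIntervals]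
    tauto
  rw [hfilter, Finset.sum_congr rfl fun T hT => by rw [(mem_tamariIntervals.1 hT).2.2.2]]
  simp

/-- Each interval contributes `x ^ (ℓ + 1) - 1` to the dividend, a geometric sum times `x - 1`. -/
theorem coeff_divXSubOne_tamariGF (n : ℕ) :
    PowerSeries.coeff n (divXSubOne (xVar * tamariGF - atXOne tamariGF)) =
      ∑ T ∈ allTamariIntervals n,
        ∑ j ∈ Finset.range (leftBranchNodes T.1 + 1), (Polynomial.X : ℤ[X]) ^ j := by
  have h : PowerSeries.coeff n (xVar * tamariGF - atXOne tamariGF) =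
      (Polynomial.X - Polynomial.C 1) * ∑ T ∈ allTamariIntervals n,
        ∑ j ∈ Finset.range (leftBranchNodes T.1 + 1), (Polynomial.X : ℤ[X]) ^ j := by
    rw [map_sub, xVar, atXOne, PowerSeries.coeff_C_mul, PowerSeries.coeff_map, coeff_tamariGF,
      map_sum, Finset.mul_sum, Finset.mul_sum, ← Finset.sum_sub_distrib]
    refine Finset.sum_congr rfl fun T _ => ?_
    rw [map_one, mul_geom_sum, pow_succ']
    simp
  rw [divXSubOne, PowerSeries.coeff_mk, h,
    Polynomial.mul_divByMonic_cancel_left _ (Polynomial.monic_X_sub_C 1)]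

/-- The intervals of size `n + 1` correspond to the pairs of intervals `P`, `Q` of total size `n`
with the choice of a number `j` of nodes on the leftmost branch of the lower end of `Q`. -/
theorem sum_allTamariIntervals_succ (n : ℕ) :
    ∑ T ∈ allTamariIntervals (n + 1), (Polynomial.X : ℤ[X]) ^ leftBranchNodes T.1 =
      ∑ p ∈ Finset.HasAntidiagonal.antidiagonal n, ∑ P ∈ allTamariIntervals p.1,
        ∑ Q ∈ allTamariIntervals p.2, ∑ j ∈ Finset.range (leftBranchNodes Q.1 + 1),
          (Polynomial.X : ℤ[X]) ^ (leftBranchNodes P.1 + 1 + j) := by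
  simp only [Finset.sum_sigma']
  symm
  refine Finset.sum_bij
    (fun s _ => (graftLeftBranch s.2.1.1 s.2.2.1.1 s.2.2.2, .node () s.2.1.2 s.2.2.1.2)) ?_ ?_ ?_ ?_
  · rintro ⟨⟨a, b⟩, ⟨P₁, P₂⟩, ⟨Q₁, Q₂⟩, j⟩ hs
    simp only [Finset.mem_sigma, Finset.HasAntidiagonal.mem_antidiagonal, mem_allTamariIntervals,
      Finset.mem_range] at hs ⊢
    obtain ⟨hab, ⟨hP₁, hP₂, hP⟩, ⟨hQ₁, hQ₂, hQ⟩, hj⟩ := hs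
    refine ⟨?_, ?_, tamariLE_node_iff.2 ⟨P₁, Q₁, j, hP, hQ, by omega, rfl⟩⟩
    · rw [numNodes_graftLeftBranch]; omega
    · simp only [BinaryTree.numNodes]; omega
  · rintro ⟨⟨a, b⟩, ⟨P₁, P₂⟩, ⟨Q₁, Q₂⟩, j⟩ hs ⟨⟨a', b'⟩, ⟨P₁', P₂'⟩, ⟨Q₁', Q₂'⟩, j'⟩ hs' h
    simp only [Finset.mem_sigma, Finset.HasAntidiagonal.mem_antidiagonal, mem_allTamariIntervals,
      Finset.mem_range] at hs hs'
    obtain ⟨hab, ⟨hP₁, hP₂, hP⟩, ⟨hQ₁, hQ₂, hQ⟩, hj⟩ := hs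
    obtain ⟨hab', ⟨hP₁', hP₂', hP'⟩, ⟨hQ₁', hQ₂', hQ'⟩, hj'⟩ := hs'
    simp only [Prod.mk.injEq, BinaryTree.node.injEq, true_and] at h
    obtain ⟨h₁, rfl, rfl⟩ := h
    -- `P₁` and `P₁'` have equal size, that of their common upper end `P₂`.
    obtain ⟨rfl, rfl, rfl⟩ :=
      graftLeftBranch_injective (by omega) (by omega) (by omega) h₁
    subst hP₁ hQ₁ hP₁' hQ₁'
    rfl
  · rintro ⟨T₁, T₂⟩ hT
    simp only [mem_allTamariIntervals] at hT
    obtain ⟨hT₁, hT₂, hT⟩ := hT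
    cases T₂ with
    | nil => simp [BinaryTree.numNodes] at hT₂
    | node _ L R =>
      obtain ⟨L', R', j, hL, hR, hj, rfl⟩ := tamariLE_node_iff.1 hT
      refine ⟨⟨(L.numNodes, R.numNodes), (L', L), (R', R), j⟩, ?_, rfl⟩
      simp only [BinaryTree.numNodes] at hT₂
      simp only [Finset.mem_sigma, Finset.HasAntidiagonal.mem_antidiagonal, mem_allTamariIntervals,
        Finset.mem_range]
      exact ⟨by omega, ⟨hL.numNodes_eq, trivial, hL⟩, ⟨hR.numNodes_eq, trivial, hR⟩, by omega⟩
  · rintro ⟨⟨a, b⟩, ⟨P₁, P₂⟩, ⟨Q₁, Q₂⟩, j⟩ hs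
    simp only [Finset.mem_sigma, Finset.mem_range] at hs
    exact congrArg _ (leftBranchNodes_graftLeftBranch P₁ Q₁ j (by omega)).symm

theorem allTamariIntervals_zero : allTamariIntervals 0 = {(.nil, .nil)} := by
  ext ⟨T₁, T₂⟩
  rw [mem_allTamariIntervals, Finset.mem_singleton]
  constructor
  · rintro ⟨h₁, h₂, -⟩
    cases T₁ <;> cases T₂ <;> simp_all [BinaryTree.numNodes]
  · rintro ⟨⟩
    exact ⟨rfl, rfl, .refl⟩

theorem mainTheorem4 : tamariGF = tamariB tamariGF tamariGF + 1 := by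
  -- With `y` in front, the coefficient at `n + 1` becomes `x` times a Cauchy product at `n`.
  have hB : tamariB tamariGF tamariGF = PowerSeries.X * (PowerSeries.C Polynomial.X *
      (tamariGF * divXSubOne (xVar * tamariGF - atXOne tamariGF))) := by
    rw [tamariB, yVar]
    nth_rw 1 [xVar]
    ring
  ext1 n
  rw [hB, map_add]
  cases n with
  | zero =>
    rw [PowerSeries.coeff_zero_X_mul, coeff_tamariGF, allTamariIntervals_zero]
    simp [leftBranchNodes]
  | succ n =>
    rw [PowerSeries.coeff_succ_X_mul, PowerSeries.coeff_C_mul, PowerSeries.coeff_mul,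
      coeff_tamariGF, sum_allTamariIntervals_succ, PowerSeries.coeff_one, if_neg n.succ_ne_zero,
      add_zero, Finset.mul_sum]
    refine Finset.sum_congr rfl fun p _ => ?_
    rw [coeff_tamariGF, coeff_divXSubOne_tamariGF, Finset.sum_mul_sum, Finset.mul_sum]
    refine Finset.sum_congr rfl fun P _ => ?_
    rw [Finset.mul_sum]
    refine Finset.sum_congr rfl fun Q _ => ?_
    rw [Finset.mul_sum, Finset.mul_sum]
    refine Finset.sum_congr rfl fun j _ => ?_
    ring
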